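/- All Banach spaces are real, and an operator is a continuous linear map between Banach spaces. For $1<p<\infty$, a Banach space $X$ has property $(R_p)$ if for every relatively weakly compact set $A\subseteq X$ which is not relatively norm compact there is an operator $u:X\to\ell_p$ such that $u(A)$ is not relatively norm compact. The projective tensor product $X\widehat{\otimes}_\pi Y$ of Banach spaces $X$ and $Y$ is the completion of the algebraic tensor product $X\otimes Y$ with respect to the norm $\|z\|=\sup\{|\tilde S(z)| : S \text{ a continuous bilinear functional on } X\times Y,\ \|S\|\le 1\}$, where $\tilde S$ is the linear functional on $X\otimes Y$ with $\tilde S(x\otimes y)=S(x,y)$. A sequence in a Banach space is weakly null if it converges to $0$ in the weak topology, and weakly Cauchy if its image under every continuous linear functional is a convergent sequence of real numbers. Let $X$ and $Y$ be Banach spaces such that $X$ has property $(R_p)$ and $Y$ has property $(R_q)$ for some $1<p,q<\infty$ satisfying $1/p+1/q\ge 1$. Let $(x_n)_{n\in\mathbb N}$ and $(y_n)_{n\in\mathbb N}$ be weakly null sequences in $X$ and $Y$, respectively. Then $(x_n\otimes y_n)_{n\in\mathbb N}$ is weakly null in $X\widehat{\otimes}_\pi Y$ if and only if it is weakly Cauchy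 in $X\widehat{\otimes}_\pi Y$. -/

import Mathlib

open Filter Topology
open scoped TensorProduct

noncomputable section

namespace ProjectiveTensor

/-- The linear functional on the algebraic tensor product `X ⊗ Y` induced by a continuous
bilinear functional `S` on `X × Y`; it maps `x ⊗ y` to `S x y`. -/
def induced {X : Type*} {Y : Type*} [NormedAddCommGroup X] [NormedSpace ℝ X]
    [NormedAddCommGroup Y] [NormedSpace ℝ Y] (S : X →L[ℝ] Y →L[ℝ] ℝ) : X ⊗[ℝ] Y →ₗ[ℝ] ℝ :=
  TensorProduct.lift (ContinuousLinearMap.coeLM ℝ ∘ₗ S.toLinearMap)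

/-- The projective norm of `z ∈ X ⊗ Y`: the supremum of `|S z|` over all continuous bilinear
functionals `S` on `X × Y` with `‖S‖ ≤ 1`. (The supremum is over a bounded set,
see `bddAbove_induced`.) -/
def projNorm {X : Type*} {Y : Type*} [NormedAddCommGroup X] [NormedSpace ℝ X]
    [NormedAddCommGroup Y] [NormedSpace ℝ Y] (z : X ⊗[ℝ] Y) : ℝ :=
  ⨆ S : {S : X →L[ℝ] Y →L[ℝ] ℝ // ‖S‖ ≤ 1}, |induced S.1 z|

theorem bddAbove_induced {X : Type*} {Y : Type*} [NormedAddCommGroup X] [NormedSpace ℝ X]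
    [NormedAddCommGroup Y] [NormedSpace ℝ Y] (z : X ⊗[ℝ] Y) :
    BddAbove (Set.range fun S : {S : X →L[ℝ] Y →L[ℝ] ℝ // ‖S‖ ≤ 1} => |induced S.1 z|) := by
  induction z with
  | zero => exact ⟨0, by rintro _ ⟨S, rfl⟩; simp⟩
  | tmul x y =>
    refine ⟨‖x‖ * ‖y‖, ?_⟩
    rintro _ ⟨S, rfl⟩
    have h : |S.1 x y| ≤ ‖S.1‖ * ‖x‖ * ‖y‖ := S.1.le_opNorm₂ x y
    have h1 : ‖S.1‖ * ‖x‖ * ‖y‖ ≤ 1 * ‖x‖ * ‖y‖ := by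
      gcongr
      exact S.2
    simpa [induced] using h.trans h1
  | add a b ha hb =>
    obtain ⟨A, hA⟩ := ha
    obtain ⟨B, hB⟩ := hb
    refine ⟨A + B, ?_⟩
    rintro _ ⟨S, rfl⟩
    have h1 := hA ⟨S, rfl⟩
    have h2 := hB ⟨S, rfl⟩
    simp only [map_add]
    exact (abs_add_le _ _).trans (add_le_add h1 h2)

theorem projNorm_smul {X : Type*} {Y : Type*} [NormedAddCommGroup X] [NormedSpace ℝ X]
    [NormedAddCommGroup Y] [NormedSpace ℝ Y] (c : ℝ) (z : X ⊗[ℝ] Y) :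
    projNorm (c • z) = ‖c‖ * projNorm z := by
  simp only [projNorm, map_smul, smul_eq_mul, abs_mul, Real.norm_eq_abs]
  rw [Real.mul_iSup_of_nonneg (abs_nonneg c)]

theorem projNorm_add_le {X : Type*} {Y : Type*} [NormedAddCommGroup X] [NormedSpace ℝ X]
    [NormedAddCommGroup Y] [NormedSpace ℝ Y] (z w : X ⊗[ℝ] Y) :
    projNorm (z + w) ≤ projNorm z + projNorm w := by
  have : Nonempty {S : X →L[ℝ] Y →L[ℝ] ℝ // ‖S‖ ≤ 1} :=
    ⟨⟨0, (norm_zero (E := X →L[ℝ] Y →L[ℝ] ℝ)).le.trans zero_le_one⟩⟩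
  refine ciSup_le fun S => ?_
  rw [map_add]
  exact (abs_add_le _ _).trans
    (add_le_add (le_ciSup (bddAbove_induced z) S) (le_ciSup (bddAbove_induced w) S))

/-- The algebraic tensor product `X ⊗ Y`, as a type of its own that carries the projective
norm. -/
def AlgTensor (X : Type*) (Y : Type*) [NormedAddCommGroup X] [NormedSpace ℝ X]
    [NormedAddCommGroup Y] [NormedSpace ℝ Y] : Type _ :=
  X ⊗[ℝ] Y

instance {X : Type*} {Y : Type*} [NormedAddCommGroup X] [NormedSpace ℝ X]
    [NormedAddCommGroup Y] [NormedSpace ℝ Y] : AddCommGroup (AlgTensor X Y) :=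
  inferInstanceAs (AddCommGroup (X ⊗[ℝ] Y))

instance {X : Type*} {Y : Type*} [NormedAddCommGroup X] [NormedSpace ℝ X]
    [NormedAddCommGroup Y] [NormedSpace ℝ Y] : Module ℝ (AlgTensor X Y) :=
  inferInstanceAs (Module ℝ (X ⊗[ℝ] Y))

instance {X : Type*} {Y : Type*} [NormedAddCommGroup X] [NormedSpace ℝ X]
    [NormedAddCommGroup Y] [NormedSpace ℝ Y] : Norm (AlgTensor X Y) :=
  ⟨fun z => projNorm (X := X) (Y := Y) z⟩

theorem core (X : Type*) (Y : Type*) [NormedAddCommGroup X] [NormedSpace ℝ X]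
    [NormedAddCommGroup Y] [NormedSpace ℝ Y] : SeminormedSpace.Core ℝ (AlgTensor X Y) where
  norm_nonneg _ := Real.iSup_nonneg fun _ => abs_nonneg _
  norm_smul c z := projNorm_smul c (X := X) (Y := Y) z
  norm_triangle z w := projNorm_add_le (X := X) (Y := Y) z w

instance {X : Type*} {Y : Type*} [NormedAddCommGroup X] [NormedSpace ℝ X]
    [NormedAddCommGroup Y] [NormedSpace ℝ Y] : SeminormedAddCommGroup (AlgTensor X Y) :=
  SeminormedAddCommGroup.ofCore (core X Y)

instance {X : Type*} {Y : Type*} [NormedAddCommGroup X] [NormedSpace ℝ X]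
    [NormedAddCommGroup Y] [NormedSpace ℝ Y] : NormedSpace ℝ (AlgTensor X Y) where
  norm_smul_le c z := ((core X Y).norm_smul c z).le

/-- The identity map from `X ⊗ Y` to its copy that carries the projective norm. -/
def toAlgTensor {X : Type*} {Y : Type*} [NormedAddCommGroup X] [NormedSpace ℝ X]
    [NormedAddCommGroup Y] [NormedSpace ℝ Y] : X ⊗[ℝ] Y ≃ₗ[ℝ] AlgTensor X Y :=
  LinearEquiv.refl ℝ (X ⊗[ℝ] Y)

end ProjectiveTensor

/-- The projective tensor product: the completion of `X ⊗ Y` for the projective norm. -/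
abbrev ProjTensor (X : Type*) (Y : Type*) [NormedAddCommGroup X] [NormedSpace ℝ X]
    [NormedAddCommGroup Y] [NormedSpace ℝ Y] : Type _ :=
  UniformSpace.Completion (ProjectiveTensor.AlgTensor X Y)

/-- The elementary tensor `x ⊗ y` as an element of the projective tensor product. -/
def ProjTensor.tmul {X : Type*} {Y : Type*} [NormedAddCommGroup X] [NormedSpace ℝ X]
    [NormedAddCommGroup Y] [NormedSpace ℝ Y] (x : X) (y : Y) : ProjTensor X Y :=
  (ProjectiveTensor.toAlgTensor (x ⊗ₜ[ℝ] y) :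
    UniformSpace.Completion (ProjectiveTensor.AlgTensor X Y))

/-- A sequence is weakly null if it converges to `0` in the weak topology. -/
def WeaklyNull {X : Type*} [NormedAddCommGroup X] [NormedSpace ℝ X] (x : ℕ → X) : Prop :=
  Tendsto (fun n => toWeakSpace ℝ X (x n)) atTop (𝓝 0)

/-- A sequence `x` is weakly Cauchy if `f (x n)` is a Cauchy (equivalently, convergent) sequence
of real numbers for every continuous linear functional `f`. -/
def WeaklyCauchy {X : Type*} [NormedAddCommGroup X] [NormedSpace ℝ X] (x : ℕ → X) : Prop :=
  ∀ f : X →L[ℝ] ℝ, CauchySeq fun n => f (x n)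

/-- A set is relatively norm compact if its norm closure is norm compact. -/
def RelNormCompact {X : Type*} [NormedAddCommGroup X] (A : Set X) : Prop :=
  IsCompact (closure A)

/-- A set is relatively weakly compact if its weak closure is weakly compact. -/
def RelWeaklyCompact {X : Type*} [NormedAddCommGroup X] [NormedSpace ℝ X] (A : Set X) : Prop :=
  IsCompact (closure (toWeakSpace ℝ X '' A))

theorem one_le_ofReal_of_one_lt {p : ℝ} (hp : 1 < p) : 1 ≤ ENNReal.ofReal p := by
  rw [ENNReal.one_le_ofReal]
  exact hp.le

/-- Property `(R_p)` for `1 < p < ∞`: every relatively weakly compact set `A` that is not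
relatively norm compact has an operator `u : X → ℓ_p` with `u(A)` not relatively norm compact. -/
def PropertyR (p : ℝ) (hp : 1 < p) (X : Type*) [NormedAddCommGroup X] [NormedSpace ℝ X] : Prop :=
  haveI : Fact (1 ≤ ENNReal.ofReal p) := ⟨one_le_ofReal_of_one_lt hp⟩
  ∀ A : Set X, RelWeaklyCompact A → ¬ RelNormCompact A →
    ∃ u : X →L[ℝ] lp (fun _ : ℕ => ℝ) (ENNReal.ofReal p), ¬ RelNormCompact (u '' A)

end

/-! Only weakly Cauchy implies weakly null needs proof. If a functional `f` fails to tend to `0`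
along `x n ⊗ y n`, then on a subsequence both norms stay bounded below. By
`WeaklyNull.exists_operator`, used once for each factor, operators `u` into `ℓ_p` and `v` into `ℓ_q`
keep the images bounded below on a further subsequence. There a simultaneous gliding hump
(`lp.exists_gliding_hump`) places both images essentially on common disjoint blocks. Norming
functionals on the even blocks alone define a form `∑ F k * G k`, bounded because `1/p + 1/q ≥ 1`
(`exists_bilinear_hasSum`). It is bounded below along even indices and tends to `0` along odd ones.
Pulled back by `u`, `v` and lifted to the tensor product, it contradicts weak Cauchyness. -/

/-! ### Projective norm and lifting of bilinear functionals. -/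

namespace ProjectiveTensor

variable {X : Type*} {Y : Type*} [NormedAddCommGroup X] [NormedSpace ℝ X]
  [NormedAddCommGroup Y] [NormedSpace ℝ Y]

theorem abs_induced_le (S : X →L[ℝ] Y →L[ℝ] ℝ) (z : X ⊗[ℝ] Y) :
    |induced S z| ≤ ‖S‖ * projNorm z := by
  rcases eq_or_ne S 0 with rfl | hS
  · have : induced (0 : X →L[ℝ] Y →L[ℝ] ℝ) = 0 := by
      ext x y
      simp [induced]
    rw [this, norm_zero (E := X →L[ℝ] Y →L[ℝ] ℝ)]
    simp
  · have hS' : 0 < ‖S‖ := (norm_pos_iff (E := X →L[ℝ] Y →L[ℝ] ℝ)).mpr hS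
    have hnorm : ‖‖S‖⁻¹ • S‖ ≤ 1 := by
      refine (S.opNorm_smul_le ‖S‖⁻¹).trans ?_
      rw [Real.norm_of_nonneg (inv_nonneg.mpr hS'.le), inv_mul_cancel₀ hS'.ne']
    have h := le_ciSup (bddAbove_induced z) ⟨‖S‖⁻¹ • S, hnorm⟩
    have hscale : induced (‖S‖⁻¹ • S) = ‖S‖⁻¹ • induced S := by
      ext x y
      simp [induced]
    have h' : ‖S‖⁻¹ * |induced S z| ≤ projNorm z := by
      simpa [hscale, abs_mul, abs_of_pos hS', projNorm] using h
    rwa [inv_mul_le_iff₀ hS'] at h'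

theorem projNorm_tmul_le (x : X) (y : Y) : projNorm (x ⊗ₜ[ℝ] y) ≤ ‖x‖ * ‖y‖ := by
  have : Nonempty {S : X →L[ℝ] Y →L[ℝ] ℝ // ‖S‖ ≤ 1} :=
    ⟨⟨0, (norm_zero (E := X →L[ℝ] Y →L[ℝ] ℝ)).le.trans zero_le_one⟩⟩
  refine ciSup_le fun S => ?_
  have h : |S.1 x y| ≤ ‖S.1‖ * ‖x‖ * ‖y‖ := S.1.le_opNorm₂ x y
  have h1 : ‖S.1‖ * ‖x‖ * ‖y‖ ≤ 1 * ‖x‖ * ‖y‖ := by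
    gcongr
    exact S.2
  simpa [induced] using h.trans h1

end ProjectiveTensor

theorem ProjTensor.norm_tmul_le {X Y : Type*} [NormedAddCommGroup X] [NormedSpace ℝ X]
    [NormedAddCommGroup Y] [NormedSpace ℝ Y] (x : X) (y : Y) :
    ‖ProjTensor.tmul x y‖ ≤ ‖x‖ * ‖y‖ := by
  rw [ProjTensor.tmul, UniformSpace.Completion.norm_coe]
  exact ProjectiveTensor.projNorm_tmul_le x y

/-- A continuous bilinear functional factors through the projective tensor product. -/
theorem ProjTensor.exists_lift {X Y : Type*} [NormedAddCommGroup X] [NormedSpace ℝ X]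
    [NormedAddCommGroup Y] [NormedSpace ℝ Y] (S : X →L[ℝ] Y →L[ℝ] ℝ) :
    ∃ F : ProjTensor X Y →L[ℝ] ℝ, ∀ x y, F (ProjTensor.tmul x y) = S x y := by
  let g : ProjectiveTensor.AlgTensor X Y →L[ℝ] ℝ :=
    LinearMap.mkContinuous (ProjectiveTensor.induced S ∘ₗ
      (ProjectiveTensor.toAlgTensor (X := X) (Y := Y)).symm.toLinearMap) ‖S‖
      fun z => ProjectiveTensor.abs_induced_le S z
  refine ⟨g.extend (UniformSpace.Completion.toComplL (𝕜 := ℝ)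
    (E := ProjectiveTensor.AlgTensor X Y)), fun x y => ?_⟩
  have h := g.extend_eq (e := UniformSpace.Completion.toComplL (𝕜 := ℝ)
    (E := ProjectiveTensor.AlgTensor X Y)) (UniformSpace.Completion.denseRange_coe)
    (UniformSpace.Completion.isUniformInducing_coe _)
    (ProjectiveTensor.toAlgTensor (x ⊗ₜ[ℝ] y))
  refine (h : _).trans ?_
  simp [g, ProjectiveTensor.induced]

/-! ### Weakly null sequences and property `(R_p)`. -/

section Weak

variable {X : Type*} [NormedAddCommGroup X] [NormedSpace ℝ X]

theorem weaklyNull_iff {x : ℕ → X} :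
    WeaklyNull x ↔ ∀ f : X →L[ℝ] ℝ, Tendsto (fun n => f (x n)) atTop (𝓝 0) := by
  have hinj : Function.Injective (topDualPairing ℝ X).flip := fun a b hab =>
    (SeparatingDual.eq_iff_forall_dual_eq (R := ℝ)).mpr fun f => LinearMap.congr_fun hab f
  have h := WeakBilin.tendsto_iff_forall_eval_tendsto (l := atTop) (topDualPairing ℝ X).flip
    (f := fun n => toWeakSpace ℝ X (x n)) (x := (0 : WeakSpace ℝ X)) hinj
  refine h.trans (forall_congr' fun f => ?_)
  change Tendsto (fun n => f (x n)) atTop (𝓝 (f 0)) ↔ _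
  rw [map_zero]

namespace WeaklyNull

theorem comp_strictMono {x : ℕ → X} (hx : WeaklyNull x) {φ : ℕ → ℕ} (hφ : StrictMono φ) :
    WeaklyNull (x ∘ φ) :=
  Filter.Tendsto.comp (g := fun n => toWeakSpace ℝ X (x n)) hx hφ.tendsto_atTop

theorem map {Z : Type*} [NormedAddCommGroup Z] [NormedSpace ℝ Z] {x : ℕ → X}
    (hx : WeaklyNull x) (u : X →L[ℝ] Z) : WeaklyNull fun n => u (x n) :=
  weaklyNull_iff.mpr fun f => weaklyNull_iff.mp hx (f.comp u)

theorem weaklyCauchy {x : ℕ → X} (hx : WeaklyNull x) : WeaklyCauchy x :=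
  fun f => (weaklyNull_iff.mp hx f).cauchySeq

/-- Uniform boundedness is applied to evaluations on the dual, which is complete even if `X` is not.
-/
theorem exists_norm_le {x : ℕ → X} (hx : WeaklyNull x) : ∃ C, ∀ n, ‖x n‖ ≤ C := by
  obtain ⟨C, hC⟩ := banach_steinhaus (g := fun n => NormedSpace.inclusionInDoubleDual ℝ X (x n))
    fun f => by
      obtain ⟨C, hC⟩ := (weaklyNull_iff.mp hx f).norm.bddAbove_range
      exact ⟨C, fun n => hC ⟨n, rfl⟩⟩
  refine ⟨C, fun n => ?_⟩
  rw [← (NormedSpace.inclusionInDoubleDualLi (E := X) ℝ).norm_map (x n)]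
  exact hC n

theorem relWeaklyCompact_range {x : ℕ → X} (hx : WeaklyNull x) :
    RelWeaklyCompact (Set.range x) := by
  refine IsCompact.closure_of_subset (Tendsto.isCompact_insert_range hx) ?_
  rw [← Set.range_comp]
  exact Set.subset_insert _ _

/-- A norm limit of a subsequence must equal the weak limit `0`, against the lower bound. -/
theorem not_relNormCompact_range {x : ℕ → X} (hx : WeaklyNull x) {δ : ℝ} (hδ : 0 < δ)
    (h : ∀ n, δ ≤ ‖x n‖) : ¬ RelNormCompact (Set.range x) := by
  intro hc
  obtain ⟨z, -, φ, hφ, hz⟩ := IsCompact.tendsto_subseq hc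
    (fun n => subset_closure (Set.mem_range_self n))
  have hz0 : z = 0 := by
    refine (SeparatingDual.eq_zero_of_forall_dual_eq_zero (R := ℝ)) fun f => ?_
    exact tendsto_nhds_unique ((f.continuous.tendsto z).comp hz)
      ((weaklyNull_iff.mp hx f).comp hφ.tendsto_atTop)
  have hle : δ ≤ ‖z‖ := ge_of_tendsto' hz.norm fun n => h (φ n)
  rw [hz0, norm_zero] at hle
  exact hδ.not_ge hle

/-- Property `(R_p)` yields an operator into `ℓ_p` that keeps a subsequence of a weakly null,
norm-bounded-below sequence bounded below. -/
theorem exists_operator {p : ℝ} {hp : 1 < p} [Fact (1 ≤ ENNReal.ofReal p)]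
    (hX : PropertyR p hp X) {x : ℕ → X} (hx : WeaklyNull x) {δ : ℝ} (hδ : 0 < δ)
    (h : ∀ n, δ ≤ ‖x n‖) :
    ∃ (u : X →L[ℝ] lp (fun _ : ℕ => ℝ) (ENNReal.ofReal p)) (ε : ℝ) (φ : ℕ → ℕ),
      0 < ε ∧ StrictMono φ ∧ ∀ n, ε ≤ ‖u (x (φ n))‖ := by
  obtain ⟨u, hu⟩ := hX _ hx.relWeaklyCompact_range (hx.not_relNormCompact_range hδ h)
  have hnt : ¬ Tendsto (fun n => u (x n)) atTop (𝓝 0) := by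
    intro ht
    refine hu (IsCompact.closure_of_subset (Tendsto.isCompact_insert_range ht) ?_)
    rw [← Set.range_comp]
    exact Set.subset_insert _ _
  rw [Metric.tendsto_nhds] at hnt
  push Not at hnt
  obtain ⟨ε, hε, hfr⟩ := hnt
  obtain ⟨φ, hφ, hφε⟩ := extraction_of_frequently_atTop hfr
  exact ⟨u, ε, φ, hε, hφ, fun n => by simpa using hφε n⟩

end WeaklyNull

end Weak

/-! ### Bilinear forms from summable coordinates. -/

/-- The exponent condition says that `q` is at most the conjugate of `p`. After Young's inequality,
`b ≤ 1` allows lowering the exponent of `b` to `q`. -/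
theorem Real.mul_le_rpow_add_rpow {p q : ℝ} (hp : 1 < p) (hq : 1 < q) (hpq : 1 ≤ 1 / p + 1 / q)
    {a b : ℝ} (ha : 0 ≤ a) (hb : 0 ≤ b) (hb1 : b ≤ 1) : a * b ≤ a ^ p + b ^ q := by
  have hc := Real.HolderConjugate.conjExponent hp
  have hqr : q ≤ p.conjExponent := by
    have h := hc.inv_add_inv_eq_one
    rw [one_div, one_div] at hpq
    exact (inv_le_inv₀ hc.symm.pos (by linarith)).mp (by linarith)
  calc a * b ≤ a ^ p / p + b ^ p.conjExponent / p.conjExponent :=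
        Real.young_inequality_of_nonneg ha hb hc
    _ ≤ a ^ p + b ^ p.conjExponent :=
        add_le_add (div_le_self (Real.rpow_nonneg ha _) hp.le)
          (div_le_self (Real.rpow_nonneg hb _) hc.symm.lt.le)
    _ ≤ a ^ p + b ^ q := by
        exact add_le_add_right
          (Real.rpow_le_rpow_of_exponent_ge' hb hb1 (by linarith) hqr) _

/-- If the coordinates `F k x` are `p`-summable with norm at most `‖x‖`, the coordinates `G k y` are
`q`-summable with norm at most `‖y‖`, and `1 / p + 1 / q ≥ 1`, then `∑ F k x * G k y` defines a
continuous bilinear functional. -/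
theorem exists_bilinear_hasSum {X Y : Type*} [NormedAddCommGroup X] [NormedSpace ℝ X]
    [NormedAddCommGroup Y] [NormedSpace ℝ Y] {p q : ℝ} (hp : 1 < p) (hq : 1 < q)
    (hpq : 1 ≤ 1 / p + 1 / q) (F : ℕ → X →L[ℝ] ℝ) (G : ℕ → Y →L[ℝ] ℝ)
    (hF : ∀ x (s : Finset ℕ), ∑ k ∈ s, |F k x| ^ p ≤ ‖x‖ ^ p)
    (hG : ∀ y (s : Finset ℕ), ∑ k ∈ s, |G k y| ^ q ≤ ‖y‖ ^ q) :
    ∃ T : X →L[ℝ] Y →L[ℝ] ℝ, ∀ x y, HasSum (fun k => F k x * G k y) (T x y) := by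
  -- Normalizing `y` forces `|G k y| ≤ 1`, as the numerical inequality requires; homogeneity then
  -- gives the general bound.
  have hunit : ∀ x y, ‖x‖ = 1 → ‖y‖ = 1 → ∀ s : Finset ℕ, ∑ k ∈ s, |F k x * G k y| ≤ 2 := by
    intro x y hx hy s
    have hG1 : ∀ k, |G k y| ≤ 1 := fun k => by
      have h := hG y {k}
      rw [Finset.sum_singleton, hy] at h
      exact (Real.rpow_le_rpow_iff (abs_nonneg _) zero_le_one (by linarith)).mp h
    calc ∑ k ∈ s, |F k x * G k y| ≤ ∑ k ∈ s, (|F k x| ^ p + |G k y| ^ q) := by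
          refine Finset.sum_le_sum fun k _ => ?_
          rw [abs_mul]
          exact Real.mul_le_rpow_add_rpow hp hq hpq (abs_nonneg _) (abs_nonneg _) (hG1 k)
      _ ≤ ‖x‖ ^ p + ‖y‖ ^ q := by
          rw [Finset.sum_add_distrib]
          exact add_le_add (hF x s) (hG y s)
      _ = 2 := by rw [hx, hy, Real.one_rpow, Real.one_rpow]; norm_num
  have hbound : ∀ x y (s : Finset ℕ), ∑ k ∈ s, |F k x * G k y| ≤ 2 * ‖x‖ * ‖y‖ := by
    intro x y s
    rcases eq_or_ne x 0 with rfl | hx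
    · simp
    rcases eq_or_ne y 0 with rfl | hy
    · simp
    have hx' := norm_pos_iff.mpr hx
    have hy' := norm_pos_iff.mpr hy
    have h := hunit (‖x‖⁻¹ • x) (‖y‖⁻¹ • y) (by simp [norm_smul, hx]) (by simp [norm_smul, hy]) s
    have heq : ∀ k, |F k (‖x‖⁻¹ • x) * G k (‖y‖⁻¹ • y)| = (‖x‖ * ‖y‖)⁻¹ * |F k x * G k y| := by
      intro k
      simp only [map_smul, smul_eq_mul, abs_mul, abs_inv, abs_norm, mul_inv]
      ring
    simp only [heq] at h
    rw [← Finset.mul_sum, inv_mul_le_iff₀ (by positivity)] at h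
    linarith
  have hsum : ∀ x y, Summable fun k => F k x * G k y := fun x y =>
    (summable_of_sum_le (fun _ => abs_nonneg _) (hbound x y)).of_abs
  let T : X →ₗ[ℝ] Y →ₗ[ℝ] ℝ := LinearMap.mk₂ ℝ (fun x y => ∑' k, F k x * G k y)
    (fun x x' y => by
      rw [← (hsum x y).tsum_add (hsum x' y)]
      simp only [map_add, add_mul])
    (fun c x y => by
      rw [smul_eq_mul, ← tsum_mul_left]
      simp only [map_smul, smul_eq_mul, mul_assoc])
    (fun x y y' => by
      rw [← (hsum x y).tsum_add (hsum x y')]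
      simp only [map_add, mul_add])
    (fun c x y => by
      rw [smul_eq_mul, ← tsum_mul_left]
      simp only [map_smul, smul_eq_mul, mul_left_comm])
  have hT : ∀ x y, ‖T x y‖ ≤ 2 * ‖x‖ * ‖y‖ := fun x y =>
    (norm_tsum_le_tsum_norm (hsum x y).norm).trans
      ((hsum x y).norm.tsum_le_of_sum_le (hbound x y))
  exact ⟨T.mkContinuous₂ 2 hT, fun x y => (hsum x y).hasSum⟩

/-! ### Block projections and gliding humps in `ℓ_P`. -/

noncomputable section

variable (P : ENNReal) [Fact (1 ≤ P)]

/-- The projection of `ℓ_P` onto the coordinates in a finite set. -/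
def lp.proj (s : Finset ℕ) :
    lp (fun _ : ℕ => ℝ) P →L[ℝ] lp (fun _ : ℕ => ℝ) P :=
  ∑ i ∈ s, (lp.singleContinuousLinearMap ℝ (fun _ : ℕ => ℝ) P i).comp
    (lp.evalCLM ℝ (fun _ : ℕ => ℝ) P i)

end

namespace lp

variable {P : ENNReal} [Fact (1 ≤ P)]

theorem proj_eq_sum (s : Finset ℕ) (a : lp (fun _ : ℕ => ℝ) P) :
    proj P s a = ∑ i ∈ s, lp.single P i (a i) := by
  simp only [proj, sum_apply]
  rfl

theorem proj_apply (s : Finset ℕ) (a : lp (fun _ : ℕ => ℝ) P) (j : ℕ) :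
    proj P s a j = if j ∈ s then a j else 0 := by
  rw [proj_eq_sum, lp.coeFn_sum, Finset.sum_apply]
  simp [Pi.single_apply]

theorem proj_proj_self (s : Finset ℕ) (a : lp (fun _ : ℕ => ℝ) P) :
    proj P s (proj P s a) = proj P s a := by
  ext j
  simp only [proj_apply]
  split_ifs <;> rfl

theorem proj_proj_of_disjoint {s t : Finset ℕ} (h : Disjoint s t) (a : lp (fun _ : ℕ => ℝ) P) :
    proj P s (proj P t a) = 0 := by
  ext j
  simp only [proj_apply, lp.coeFn_zero, Pi.zero_apply]
  split_ifs with h1 h2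
  · exact absurd h2 (Finset.disjoint_left.mp h h1)
  · rfl
  · rfl

theorem proj_Ico {m n : ℕ} (h : m ≤ n) (a : lp (fun _ : ℕ => ℝ) P) :
    proj P (Finset.Ico m n) a = proj P (Finset.range n) a - proj P (Finset.range m) a := by
  simp only [proj_eq_sum]
  exact Finset.sum_Ico_eq_sub _ h

/-- Disjoint blocks use disjoint sets of coordinates in the sum for `‖a‖ ^ P.toReal`. -/
theorem sum_norm_proj_rpow_le (hP : 0 < P.toReal) {B : ℕ → Finset ℕ}
    (hB : Pairwise fun i j => Disjoint (B i) (B j)) (a : lp (fun _ : ℕ => ℝ) P) (s : Finset ℕ) :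
    ∑ k ∈ s, ‖proj P (B k) a‖ ^ P.toReal ≤ ‖a‖ ^ P.toReal := by
  simp only [proj_eq_sum, lp.norm_sum_single hP]
  rw [← Finset.sum_biUnion fun i _ j _ hij => hB hij]
  exact lp.sum_rpow_le_norm_rpow hP a _

theorem tendsto_proj_range (hP : P ≠ ⊤) (a : lp (fun _ : ℕ => ℝ) P) :
    Tendsto (fun n => proj P (Finset.range n) a) atTop (𝓝 a) := by
  simp only [proj_eq_sum]
  exact (lp.hasSum_single hP a).tendsto_sum_nat

theorem tendsto_proj_zero {a : ℕ → lp (fun _ : ℕ => ℝ) P}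
    (ha : ∀ i, Tendsto (fun n => a n i) atTop (𝓝 0)) (s : Finset ℕ) :
    Tendsto (fun n => proj P s (a n)) atTop (𝓝 0) := by
  simp only [proj_eq_sum]
  rw [← Finset.sum_const_zero (s := s)]
  refine tendsto_finsetSum _ fun i _ => ?_
  have h := ((lp.singleContinuousLinearMap ℝ (fun _ : ℕ => ℝ) P i).continuous.tendsto 0).comp (ha i)
  rw [map_zero] at h
  exact h

/-- As `M → ∞` the remainder tends to the head on `range N`, which is small for large `n`. -/
theorem eventually_exists_norm_sub_proj_Ico_lt (hP : P ≠ ⊤) {a : ℕ → lp (fun _ : ℕ => ℝ) P}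
    (ha : ∀ i, Tendsto (fun n => a n i) atTop (𝓝 0)) (N : ℕ) {η : ℝ} (hη : 0 < η) :
    ∀ᶠ n in atTop, ∀ᶠ M in atTop, ‖a n - proj P (Finset.Ico N M) (a n)‖ < η := by
  have h := (tendsto_proj_zero ha (Finset.range N)).norm
  rw [norm_zero] at h
  filter_upwards [h.eventually_lt_const hη] with n hn
  have h2 : Tendsto (fun M => ‖a n - (proj P (Finset.range M) (a n)
      - proj P (Finset.range N) (a n))‖) atTop (𝓝 ‖proj P (Finset.range N) (a n)‖) := by
    have h3 := ((tendsto_proj_range hP (a n)).sub_const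
      (proj P (Finset.range N) (a n))).const_sub (a n)
    simpa using h3.norm
  filter_upwards [h2.eventually_lt_const hn, eventually_ge_atTop N] with M hM hNM
  rwa [proj_Ico hNM]

/-- Simultaneous gliding hump: along a subsequence, two coordinatewise null sequences are
asymptotically supported on the same successive blocks. -/
theorem exists_gliding_hump {Q : ENNReal} [Fact (1 ≤ Q)] (hP : P ≠ ⊤) (hQ : Q ≠ ⊤)
    {a : ℕ → lp (fun _ : ℕ => ℝ) P} {b : ℕ → lp (fun _ : ℕ => ℝ) Q}
    (ha : ∀ i, Tendsto (fun n => a n i) atTop (𝓝 0))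
    (hb : ∀ i, Tendsto (fun n => b n i) atTop (𝓝 0)) :
    ∃ (φ : ℕ → ℕ) (B : ℕ → Finset ℕ), StrictMono φ ∧
      (Pairwise fun i j => Disjoint (B i) (B j)) ∧
      Tendsto (fun k => a (φ k) - proj P (B k) (a (φ k))) atTop (𝓝 0) ∧
      Tendsto (fun k => b (φ k) - proj Q (B k) (b (φ k))) atTop (𝓝 0) := by
  -- Both smallness conditions hold eventually, so one `n` and one `M` serve both sequences.
  have step : ∀ (k N m : ℕ), ∃ n M : ℕ, m < n ∧ N ≤ M ∧
      ‖a n - proj P (Finset.Ico N M) (a n)‖ < 1 / ((k : ℝ) + 1) ∧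
      ‖b n - proj Q (Finset.Ico N M) (b n)‖ < 1 / ((k : ℝ) + 1) := by
    intro k N m
    have hη : 0 < 1 / ((k : ℝ) + 1) := by positivity
    obtain ⟨n, hna, hnb, hmn⟩ := ((eventually_exists_norm_sub_proj_Ico_lt hP ha N hη).and
      ((eventually_exists_norm_sub_proj_Ico_lt hQ hb N hη).and (eventually_gt_atTop m))).exists
    obtain ⟨M, hMa, hMb, hNM⟩ := (hna.and (hnb.and (eventually_ge_atTop N))).exists
    exact ⟨n, M, hmn, hNM, hMa, hMb⟩
  choose n M hn hM hna hnb using step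
  -- The state is the last chosen index and the end of the last block. The initial index `0` is not
  -- a choice, hence the shift in `φ`.
  let s : ℕ → ℕ × ℕ := fun k => Nat.rec (0, 0) (fun k r => (n k r.2 r.1, M k r.2 r.1)) k
  have hmono : Monotone fun k => (s k).2 := monotone_nat_of_le_succ fun k => hM k _ _
  refine ⟨fun k => (s (k + 1)).1, fun k => Finset.Ico (s k).2 (s (k + 1)).2,
    strictMono_nat_of_lt_succ fun k => hn (k + 1) _ _, ?_, ?_, ?_⟩
  · intro i j hij
    have h := hmono.pairwise_disjoint_on_Ico_succ hij
    rwa [← Finset.disjoint_coe, Finset.coe_Ico, Finset.coe_Ico]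
  · exact squeeze_zero_norm (fun k => (hna k _ _).le) tendsto_one_div_add_atTop_nhds_zero_nat
  · exact squeeze_zero_norm (fun k => (hnb k _ _).le) tendsto_one_div_add_atTop_nhds_zero_nat

end lp

/-! ### An oscillating bilinear form. -/

/-- If `1 / P + 1 / Q ≥ 1`, two coordinatewise null sequences in `ℓ_P` and `ℓ_Q` that are bounded
below in norm admit a continuous bilinear functional that does not converge along them. -/
theorem lp.exists_bilinear_not_cauchySeq {P Q : ENNReal} [Fact (1 ≤ P)] [Fact (1 ≤ Q)]
    (hP : 1 < P.toReal) (hQ : 1 < Q.toReal) (hPQ : 1 ≤ 1 / P.toReal + 1 / Q.toReal)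
    {a : ℕ → lp (fun _ : ℕ => ℝ) P} {b : ℕ → lp (fun _ : ℕ => ℝ) Q}
    (ha : ∀ i, Tendsto (fun n => a n i) atTop (𝓝 0))
    (hb : ∀ i, Tendsto (fun n => b n i) atTop (𝓝 0))
    {C α β : ℝ} (hbC : ∀ n, ‖b n‖ ≤ C) (hα : 0 < α) (hβ : 0 < β)
    (haα : ∀ n, α ≤ ‖a n‖) (hbβ : ∀ n, β ≤ ‖b n‖) :
    ∃ T : lp (fun _ : ℕ => ℝ) P →L[ℝ] lp (fun _ : ℕ => ℝ) Q →L[ℝ] ℝ,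
      ¬ CauchySeq fun n => T (a n) (b n) := by
  have hPtop : P ≠ ⊤ := fun h => by simp [h] at hP; linarith
  have hQtop : Q ≠ ⊤ := fun h => by simp [h] at hQ; linarith
  obtain ⟨φ, B, hφ, hB, hta, htb⟩ := lp.exists_gliding_hump hPtop hQtop ha hb
  choose f hf1 hf using fun k => exists_dual_vector'' ℝ (proj P (B k) (a (φ k)))
  choose g hg1 hg using fun k => exists_dual_vector'' ℝ (proj Q (B k) (b (φ k)))
  -- Dropping the odd blocks creates the oscillation.
  let F : ℕ → lp (fun _ : ℕ => ℝ) P →L[ℝ] ℝ := fun k =>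
    if Even k then (f k).comp (proj P (B k)) else 0
  let G : ℕ → lp (fun _ : ℕ => ℝ) Q →L[ℝ] ℝ := fun k => (g k).comp (proj Q (B k))
  have hF : ∀ k x, |F k x| ≤ ‖proj P (B k) x‖ := by
    intro k x
    by_cases hk : Even k
    · simpa [F, hk] using (f k).le_of_opNorm_le (hf1 k) (proj P (B k) x)
    · simp [F, hk]
  have hG : ∀ k y, |G k y| ≤ ‖proj Q (B k) y‖ := fun k y => by
    simpa [G] using (g k).le_of_opNorm_le (hg1 k) (proj Q (B k) y)
  obtain ⟨T, hT⟩ := exists_bilinear_hasSum hP hQ hPQ F G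
    (fun x s => (Finset.sum_le_sum fun k _ =>
      Real.rpow_le_rpow (abs_nonneg _) (hF k x) (by linarith)).trans
        (sum_norm_proj_rpow_le (by linarith) hB x s))
    (fun y s => (Finset.sum_le_sum fun k _ =>
      Real.rpow_le_rpow (abs_nonneg _) (hG k y) (by linarith)).trans
        (sum_norm_proj_rpow_le (by linarith) hB y s))
  refine ⟨T, fun hC => ?_⟩
  obtain ⟨c, hc⟩ := cauchySeq_tendsto_of_complete hC
  -- Truncating the first argument alone suffices: disjointness makes every `F j` with `j ≠ k`
  -- vanish on it.
  have hdiag : ∀ k, T (proj P (B k) (a (φ k))) (b (φ k)) =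
      if Even k then ‖proj P (B k) (a (φ k))‖ * ‖proj Q (B k) (b (φ k))‖ else 0 := by
    intro k
    have hs : HasSum (fun j => F j (proj P (B k) (a (φ k))) * G j (b (φ k))) _ :=
      hasSum_single k fun j hj => by
        have h0 := hF j (proj P (B k) (a (φ k)))
        rw [proj_proj_of_disjoint (hB hj), norm_zero] at h0
        rw [abs_nonpos_iff.mp h0, zero_mul]
    rw [(hT _ _).unique hs]
    by_cases hk : Even k
    · simp [F, G, hk, proj_proj_self, hf, hg]
    · simp [F, hk]
  have hoff : Tendsto (fun k => T (a (φ k) - proj P (B k) (a (φ k))) (b (φ k))) atTop (𝓝 0) := by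
    have h := (hta.norm.const_mul ‖T‖).mul_const C
    rw [norm_zero, mul_zero, zero_mul] at h
    refine squeeze_zero_norm (fun k => (T.le_opNorm₂ _ _).trans ?_) h
    gcongr
    exact hbC _
  have hmain : Tendsto (fun k => if Even k then
      ‖proj P (B k) (a (φ k))‖ * ‖proj Q (B k) (b (φ k))‖ else 0) atTop (𝓝 c) := by
    have h := (hc.comp hφ.tendsto_atTop).sub hoff
    rw [sub_zero] at h
    refine h.congr fun k => ?_
    rw [← hdiag, Function.comp_apply, map_sub, sub_apply, sub_sub_cancel]
  have heven : Tendsto (fun k : ℕ => 2 * k) atTop atTop :=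
    tendsto_atTop_mono (fun k => by simp only [id]; omega) tendsto_id
  have hodd : Tendsto (fun k : ℕ => 2 * k + 1) atTop atTop :=
    tendsto_atTop_mono (fun k => by simp only [id]; omega) tendsto_id
  have hc0 : c = 0 := by
    refine tendsto_nhds_unique (hmain.comp hodd) (tendsto_const_nhds.congr fun k => ?_)
    simp
  -- The blocks carry all but a vanishing part of the norm, so half the lower bound survives.
  have hlow : ∀ {R : ENNReal} [Fact (1 ≤ R)] {w : ℕ → lp (fun _ : ℕ => ℝ) R} {γ : ℝ}, 0 < γ →
      (∀ n, γ ≤ ‖w n‖) → Tendsto (fun k => w (φ k) - proj R (B k) (w (φ k))) atTop (𝓝 0) →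
      ∀ᶠ k in atTop, γ / 2 ≤ ‖proj R (B k) (w (φ k))‖ := by
    intro R _ w γ hγ hw ht
    have h := ht.norm
    rw [norm_zero] at h
    filter_upwards [h.eventually_lt_const (half_pos hγ)] with k hk
    have h1 := norm_sub_norm_le (w (φ k)) (proj R (B k) (w (φ k)))
    linarith [hw (φ k)]
  have hge : α / 2 * (β / 2) ≤ c := by
    refine ge_of_tendsto (hmain.comp heven) ?_
    filter_upwards [heven.eventually (hlow hα haα hta), heven.eventually (hlow hβ hbβ htb)]
      with k h1 h2
    simp only [Function.comp_apply, even_two_mul, if_true]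
    exact mul_le_mul h1 h2 (by positivity) (norm_nonneg _)
  rw [hc0] at hge
  exact absurd hge (not_le.mpr (by positivity))

/-! ### From weakly Cauchy to weakly null. -/

theorem ProjTensor.weaklyNull_tmul_of_weaklyCauchy {X : Type*} {Y : Type*}
    [NormedAddCommGroup X] [NormedSpace ℝ X] [NormedAddCommGroup Y] [NormedSpace ℝ Y]
    {p q : ℝ} {hp : 1 < p} {hq : 1 < q} (hpq : 1 ≤ 1 / p + 1 / q)
    (hX : PropertyR p hp X) (hY : PropertyR q hq Y)
    {x : ℕ → X} {y : ℕ → Y} (hx : WeaklyNull x) (hy : WeaklyNull y)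
    (h : WeaklyCauchy fun n => ProjTensor.tmul (x n) (y n)) :
    WeaklyNull fun n => ProjTensor.tmul (x n) (y n) := by
  have : Fact (1 ≤ ENNReal.ofReal p) := ⟨one_le_ofReal_of_one_lt hp⟩
  have : Fact (1 ≤ ENNReal.ofReal q) := ⟨one_le_ofReal_of_one_lt hq⟩
  have hp' : (ENNReal.ofReal p).toReal = p := ENNReal.toReal_ofReal (by linarith)
  have hq' : (ENNReal.ofReal q).toReal = q := ENNReal.toReal_ofReal (by linarith)
  rw [weaklyNull_iff]
  intro f
  by_contra hf
  rw [Metric.tendsto_nhds] at hf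
  push Not at hf
  obtain ⟨ε, hε, hfr⟩ := hf
  obtain ⟨φ, hφ, hφε⟩ := extraction_of_frequently_atTop hfr
  obtain ⟨A, hA⟩ := hx.exists_norm_le
  obtain ⟨B, hB⟩ := hy.exists_norm_le
  have hA0 : 0 ≤ A := (norm_nonneg _).trans (hA 0)
  have hB0 : 0 ≤ B := (norm_nonneg _).trans (hB 0)
  have hε' : ∀ n, ε ≤ ‖f‖ * (‖x (φ n)‖ * ‖y (φ n)‖) := fun n => by
    have h1 : ε ≤ ‖f (ProjTensor.tmul (x (φ n)) (y (φ n)))‖ := by simpa using hφε n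
    exact h1.trans ((f.le_opNorm _).trans
      (mul_le_mul_of_nonneg_left (ProjTensor.norm_tmul_le _ _) (norm_nonneg _)))
  -- The `+ 1` only keeps the denominator positive.
  have hxlow : ∀ n, ε / (‖f‖ * B + 1) ≤ ‖x (φ n)‖ := fun n => by
    rw [div_le_iff₀ (by positivity)]
    have h1 : ‖f‖ * (‖x (φ n)‖ * ‖y (φ n)‖) ≤ ‖f‖ * (‖x (φ n)‖ * B) := by
      gcongr
      exact hB _
    linarith [hε' n, norm_nonneg (x (φ n))]
  have hylow : ∀ n, ε / (‖f‖ * A + 1) ≤ ‖y (φ n)‖ := fun n => by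
    rw [div_le_iff₀ (by positivity)]
    have h1 : ‖f‖ * (‖x (φ n)‖ * ‖y (φ n)‖) ≤ ‖f‖ * (A * ‖y (φ n)‖) := by
      gcongr
      exact hA _
    linarith [hε' n, norm_nonneg (y (φ n))]
  obtain ⟨u, α, ψ, hα, hψ, hu⟩ :=
    (hx.comp_strictMono hφ).exists_operator hX (by positivity) hxlow
  -- Extracting along `φ ∘ ψ` preserves the lower bound already obtained for `u`.
  obtain ⟨v, β, χ, hβ, hχ, hv⟩ :=
    (hy.comp_strictMono (hφ.comp hψ)).exists_operator hY (by positivity) fun n => hylow (ψ n)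
  let θ : ℕ → ℕ := fun n => φ (ψ (χ n))
  have hθ : StrictMono θ := hφ.comp (hψ.comp hχ)
  obtain ⟨C, hC⟩ := (hy.map v).exists_norm_le
  obtain ⟨T, hT⟩ := lp.exists_bilinear_not_cauchySeq (P := ENNReal.ofReal p)
    (Q := ENNReal.ofReal q) (by rwa [hp']) (by rwa [hq']) (by rwa [hp', hq'])
    (a := fun n => u (x (θ n))) (b := fun n => v (y (θ n)))
    (fun i => (weaklyNull_iff.mp ((hx.map u).comp_strictMono hθ)
      (lp.evalCLM ℝ (fun _ : ℕ => ℝ) (ENNReal.ofReal p) i)))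
    (fun i => (weaklyNull_iff.mp ((hy.map v).comp_strictMono hθ)
      (lp.evalCLM ℝ (fun _ : ℕ => ℝ) (ENNReal.ofReal q) i)))
    (fun n => hC (θ n)) hα hβ (fun n => hu (χ n)) hv
  obtain ⟨G, hG⟩ := ProjTensor.exists_lift (T.bilinearComp u v)
  have hGθ : CauchySeq fun n => G (ProjTensor.tmul (x (θ n)) (y (θ n))) :=
    (h G).comp_tendsto hθ.tendsto_atTop
  simp only [hG] at hGθ
  exact hT hGθ

theorem corollary3p12 {X : Type*} {Y : Type*}
    [NormedAddCommGroup X] [NormedSpace ℝ X] [CompleteSpace X]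
    [NormedAddCommGroup Y] [NormedSpace ℝ Y] [CompleteSpace Y]
    (p q : ℝ) (hp : 1 < p) (hq : 1 < q) (hpq : 1 ≤ 1 / p + 1 / q)
    (hX : PropertyR p hp X) (hY : PropertyR q hq Y)
    (x : ℕ → X) (y : ℕ → Y) (hx : WeaklyNull x) (hy : WeaklyNull y) :
    WeaklyNull (fun n => ProjTensor.tmul (x n) (y n)) ↔
      WeaklyCauchy (fun n => ProjTensor.tmul (x n) (y n)) :=
  ⟨fun h => h.weaklyCauchy,
    ProjTensor.weaklyNull_tmul_of_weaklyCauchy hpq hX hY hx hy⟩
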